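/- Let $F$ be a finite field with $q$ elements and $G=\mathrm{GL}_3(F)$. Let $B\le G$ be the subgroup of upper triangular matrices and $U\le B$ the subgroup of those with all diagonal entries equal to $1$. The group $U$ acts from the left on the flag variety $X=G/B$, and its orbits are the cells $UwB$, $w\in S_3$ (where $w$ is identified with its permutation matrix). The Burnside process on $X$ is the Markov chain with transition probabilities $$P(x,y)=\frac{1}{|\mathrm{stab}_U(x)|}\sum_{g\in \mathrm{stab}_U(x)\cap \mathrm{stab}_U(y)}\frac{1}{|\{z\in X: gz=z\}|}.$$ Lumping it to $U$-orbits gives the Markov chain on $S_3$ with transition matrix $K(w,z)=\sum_{y\in UzB}P(x,y)$ for any $x\in UwB$ (the sum does not depend on $x$). For $w\in S_3$ and $l\ge 1$ let $$\|K^l(w,\cdot)-\pi\|=\frac12\sum_{z\in S_3}\left|K^l(w,z)-\frac16\right|$$ be the total variation distance to the uniform distribution $\pi$ on $S_3$. Then for all $l\ge 1$ and all $w\in S_3$, $$\|K^l(w,\cdot)-\pi\|\le\sqrt{\frac32}\left(1-\frac{3}{2q+1}\right)^l,$$ and for all $l\ge1$ and all $w\in S_3$ other than the identity and the longest element $w_0$,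 $$\frac12\left(1-\frac{3}{2q+1}\right)^l\le\|K^l(w,\cdot)-\pi\|.$$ -/

import Mathlib

section Burnside

/-- One step of the Burnside process for a finite group `G` acting on a finite set `X`: from `x`
choose `g` uniformly in the stabilizer of `x`, then choose `y` uniformly among the fixed points
of `g`.  This is the probability of moving from `x` to `y`. -/
noncomputable def burnsideKernel (G : Type*) {X : Type*} [Group G] [MulAction G X]
    [Finite G] [Finite X] (x y : X) : ℝ :=
  (Nat.card (MulAction.stabilizer G x) : ℝ)⁻¹ *
    ∑ᶠ g ∈ (MulAction.stabilizer G x ⊓ MulAction.stabilizer G y : Subgroup G),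
      (Nat.card (MulAction.fixedBy X g) : ℝ)⁻¹

theorem burnsideKernel_smul_smul {G : Type*} {X : Type*} [Group G] [MulAction G X]
    [Finite G] [Finite X] (h : G) (x y : X) :
    burnsideKernel G (h • x) (h • y) = burnsideKernel G x y := by
  unfold burnsideKernel
  have hmem : ∀ (z : X) (g : G), MulAut.conj h g ∈ MulAction.stabilizer G (h • z) ↔
      g ∈ MulAction.stabilizer G z := by
    intro z g
    simp [MulAction.mem_stabilizer_iff, mul_smul]
  congr 1
  · congr 2
    exact (Nat.card_congr ((MulAut.conj h).toEquiv.subtypeEquiv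
      (fun g => (hmem x g).symm))).symm
  · refine (finsum_eq_of_bijective (MulAut.conj h) (MulAut.conj h).bijective ?_).symm
    intro g
    have h1 : (MulAut.conj h g ∈ (MulAction.stabilizer G (h • x) ⊓
        MulAction.stabilizer G (h • y) : Subgroup G)) ↔
        g ∈ (MulAction.stabilizer G x ⊓ MulAction.stabilizer G y : Subgroup G) := by
      rw [Subgroup.mem_inf, Subgroup.mem_inf, hmem, hmem]
    have h2 : Nat.card (MulAction.fixedBy X (MulAut.conj h g)) =
        Nat.card (MulAction.fixedBy X g) := by
      refine (Nat.card_congr ((MulAction.toPerm h).subtypeEquiv fun z => ?_)).symm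
      simp [MulAction.mem_fixedBy, mul_smul]
    rw [h2]
    exact finsum_congr_Prop (propext h1.symm) fun _ => rfl

/-- The Burnside process lumped to orbits: the probability of moving from the orbit `O` to the
orbit `O'` is the probability that one step from any point of `O` lands in `O'`. -/
noncomputable def burnsideOrbitKernel (G X : Type*) [Group G] [MulAction G X]
    [Finite G] [Finite X] (O O' : MulAction.orbitRel.Quotient G X) : ℝ :=
  Quotient.liftOn' O (fun x => ∑ᶠ y ∈ O'.orbit, burnsideKernel G x y) (by
    rintro _ x ⟨h, rfl⟩
    refine (finsum_eq_of_bijective (MulAction.toPerm h) (MulAction.toPerm h).bijective ?_).symm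
    intro y
    have hy : MulAction.toPerm h y ∈ O'.orbit ↔ y ∈ O'.orbit := by
      rw [MulAction.orbitRel.Quotient.mem_orbit, MulAction.orbitRel.Quotient.mem_orbit,
        MulAction.toPerm_apply, show (Quotient.mk'' (h • y) : MulAction.orbitRel.Quotient G X) =
          Quotient.mk'' y from Quotient.sound' ⟨h, rfl⟩]
    exact finsum_congr_Prop (propext hy.symm) fun _ =>
      (burnsideKernel_smul_smul h x y).symm)

end Burnside

section FlagVariety

theorem Matrix.IsUpperTriangular.mul_apply_diag {n : ℕ} {F : Type*} [Field F]
    {M N : Matrix (Fin n) (Fin n) F} (hM : M.IsUpperTriangular) (hN : N.IsUpperTriangular)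
    (i : Fin n) : (M * N) i i = M i i * N i i := by
  rw [Matrix.mul_apply, Finset.sum_eq_single i]
  · intro j _ hj
    rcases lt_or_gt_of_ne hj with h | h
    · rw [hM h, zero_mul]
    · rw [hN h, mul_zero]
  · simp

theorem Matrix.GeneralLinearGroup.isUpperTriangular_inv {n : ℕ} {F : Type*} [Field F]
    (g : GL (Fin n) F) (hg : (g : Matrix (Fin n) (Fin n) F).IsUpperTriangular) :
    ((g⁻¹ : GL (Fin n) F) : Matrix (Fin n) (Fin n) F).IsUpperTriangular := by
  let _ : Invertible (g : Matrix (Fin n) (Fin n) F) := g.invertible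
  rw [Matrix.coe_units_inv]
  exact Matrix.blockTriangular_inv_of_blockTriangular hg

/-- The subgroup `B` of upper triangular matrices in `GL_n(F)`. -/
def upperBorel (n : ℕ) (F : Type*) [Field F] : Subgroup (GL (Fin n) F) where
  carrier := {g | (g : Matrix (Fin n) (Fin n) F).IsUpperTriangular}
  mul_mem' := by
    intro g h hg hh
    simpa using Matrix.BlockTriangular.mul hg hh
  one_mem' := by
    simpa using Matrix.blockTriangular_one (b := (id : Fin n → Fin n)) (R := F)
  inv_mem' := by
    intro g hg
    exact g.isUpperTriangular_inv hg

/-- The subgroup `U` of unipotent upper triangular matrices (those with every diagonal entry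
equal to `1`) in `GL_n(F)`. -/
def upperUnipotent (n : ℕ) (F : Type*) [Field F] : Subgroup (GL (Fin n) F) where
  carrier := {g | (g : Matrix (Fin n) (Fin n) F).IsUpperTriangular ∧
    ∀ i, (g : Matrix (Fin n) (Fin n) F) i i = 1}
  mul_mem' := by
    rintro g h ⟨hg, hg'⟩ ⟨hh, hh'⟩
    refine ⟨by simpa using Matrix.BlockTriangular.mul hg hh, fun i => ?_⟩
    rw [Units.val_mul, hg.mul_apply_diag hh, hg', hh', one_mul]
  one_mem' := by
    refine ⟨by simpa using Matrix.blockTriangular_one (b := (id : Fin n → Fin n)) (R := F), ?_⟩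
    simp
  inv_mem' := by
    rintro g ⟨hg, hg'⟩
    refine ⟨g.isUpperTriangular_inv hg, fun i => ?_⟩
    have h := hg.mul_apply_diag (g.isUpperTriangular_inv hg) i
    rw [← Units.val_mul, mul_inv_cancel, Units.val_one, Matrix.one_apply_eq, hg', one_mul] at h
    exact h.symm

/-- The variety of complete flags of `F ^ n`, as the coset space `G / B`, with `G = GL_n(F)`
acting from the left. -/
abbrev FlagVariety (n : ℕ) (F : Type*) [Field F] : Type _ :=
  GL (Fin n) F ⧸ upperBorel n F

/-- The permutation matrix of `w`, sending the basis vector `e_j` to `e_{w(j)}`, as an element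
of `GL_n(F)`. -/
def permGL {n : ℕ} (F : Type*) [Field F] (w : Equiv.Perm (Fin n)) : GL (Fin n) F where
  val := w⁻¹.permMatrix F
  inv := w.permMatrix F
  val_inv := by rw [← Matrix.permMatrix_mul, mul_inv_cancel, Matrix.permMatrix_one]
  inv_val := by rw [← Matrix.permMatrix_mul, inv_mul_cancel, Matrix.permMatrix_one]

/-- The `U`-orbit `U w B` in `G / B`. -/
def bruhatCell {n : ℕ} (F : Type*) [Field F] (w : Equiv.Perm (Fin n)) :
    MulAction.orbitRel.Quotient (upperUnipotent n F) (FlagVariety n F) :=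
  Quotient.mk'' (QuotientGroup.mk (permGL F w))

/-- The transition matrix on the symmetric group of the Burnside process for the action of `U` on
`G / B`, lumped to orbits, the orbit `U w B` being labelled by the permutation `w`. -/
noncomputable def flagBurnsideMatrix (n : ℕ) (F : Type*) [Field F] [Finite F] :
    Matrix (Equiv.Perm (Fin n)) (Equiv.Perm (Fin n)) ℝ :=
  Matrix.of fun w z =>
    burnsideOrbitKernel (upperUnipotent n F) (FlagVariety n F) (bruhatCell F w) (bruhatCell F z)

end FlagVariety

/-- The total variation distance between two probability mass functions on a finite set. -/
noncomputable def tvDist {α : Type*} [Fintype α] (μ ν : α → ℝ) : ℝ :=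
  (1 / 2) * ∑ a, |μ a - ν a|

/-!
Averaging the definition of the Burnside kernel over an orbit gives, for a finite group `G` acting
on a finite set, the lumped kernel
`K (O, O') = |G|⁻¹ ∑ g, |Fix g ∩ O| * |Fix g ∩ O'| / |Fix g|` (`burnsideOrbitKernel_mk`), so `K` is
symmetric and positive semidefinite.

For `U` acting on the flags of `F ^ 3` the orbits are the six Bruhat cells. With coordinates
`(a, b, c)` on `U`, conjugation changes `c` only, to `c + a y - b x`, and `u w B` is fixed by `g`
exactly when `u⁻¹ g u` vanishes at the inversions of `w`. The vector of fixed point counts in the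
cells therefore takes only five values (`orbitFixCount_weylThree`), and `K` is a combination of
five rank-one matrices with coefficients rational in `q` (`flagBurnsideMatrix_three_eq`).

Put `β = 1 - 3 / (2 q + 1)`. On vectors of sum zero the form of `K` lies between `0` and `β`
(`dotProduct_lumpedMatrix_le`), so that `K` contracts the `ℓ²` distance to the uniform
distribution by `β` at each step; Cauchy-Schwarz turns this into the upper bound
(`tvDist_pow_le`). For the lower bound, the vector with values `1` and `-1` on the four
permutations other than the identity and the longest element, and `0` on these two, is an
eigenvector for `β` (`lumpedMatrix_mulVec_antisymm`), and it serves as a test function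
(`le_tvDist_pow`).
-/

/-! ### The lumped Burnside process as an average over the group -/

section OrbitFormula

open MulAction

theorem natCard_subtype_eq_sum_ite {α : Type*} [Fintype α] (p : α → Prop) [DecidablePred p] :
    (Nat.card {a // p a} : ℝ) = ∑ a, if p a then 1 else 0 := by
  simp [Nat.card_eq_fintype_card, Fintype.card_subtype, Finset.sum_boole]

variable {G X : Type*} [Group G] [MulAction G X]

/-- The number of fixed points of `g` in the orbit of `x`, as a real number. -/
noncomputable def orbitFixCount (x : X) (g : G) : ℝ :=
  Nat.card {y : orbit G x // g • (y : X) = y}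

/-- Each fixed point in the orbit of `x` is `u • x` for exactly `|stab x|` elements `u`. -/
theorem card_stabilizer_mul_orbitFixCount (x : X) (g : G) :
    (Nat.card (stabilizer G x) : ℝ) * orbitFixCount x g =
      Nat.card {u : G // g • u • x = u • x} := by
  rw [orbitFixCount, mul_comm, ← Nat.cast_mul, ← Nat.card_prod]
  congr 1
  choose h hh using fun y : orbit G x => y.2
  simp only at hh
  refine Nat.card_congr (Equiv.ofBijective
    (fun p => ⟨h p.1.1 * p.2, by rw [mul_smul, p.2.2, hh, p.1.2]⟩) ⟨?_, ?_⟩)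
  · rintro ⟨⟨y, hy⟩, s⟩ ⟨⟨y', hy'⟩, s'⟩ he
    have he' : h y * s = h y' * s' := congrArg Subtype.val he
    have hy : y = y' := by
      have := congrArg (· • x) he'
      simp only [mul_smul] at this
      rw [s.2, s'.2, hh, hh] at this
      exact Subtype.ext this
    subst hy
    simpa using he'
  · rintro ⟨u, hu⟩
    refine ⟨⟨⟨⟨u • x, u, rfl⟩, hu⟩, ⟨(h ⟨u • x, u, rfl⟩)⁻¹ * u, ?_⟩⟩, ?_⟩
    · rw [mem_stabilizer_iff, mul_smul, inv_smul_eq_iff, hh]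
    · simp

/-- The fixed points of `g`, sorted by orbits. -/
theorem card_fixedBy_eq_sum_orbitFixCount [Finite X] {ι : Type*} [Fintype ι] {x : ι → X}
    (hx : Function.Bijective fun i => (Quotient.mk'' (x i) : orbitRel.Quotient G X)) (g : G) :
    (Nat.card (fixedBy X g) : ℝ) = ∑ i, orbitFixCount (x i) g := by
  simp only [orbitFixCount]
  rw [← Nat.cast_sum, ← Nat.card_sigma]
  congr 1
  refine (Nat.card_congr (Equiv.ofBijective
    (fun p : Σ i, {y : orbit G (x i) // g • (y : X) = y} => ⟨(p.2 : X), p.2.2⟩) ⟨?_, ?_⟩)).symm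
  · rintro ⟨i, ⟨y, hy⟩, hgy⟩ ⟨i', ⟨y', hy'⟩, hgy'⟩ he
    have he' : y = y' := congrArg Subtype.val he
    subst he'
    have hi : i = i' := hx.1 <|
      ((Quotient.sound' hy : (Quotient.mk'' y : orbitRel.Quotient G X) = _)).symm.trans
        (Quotient.sound' hy')
    subst hi
    rfl
  · rintro ⟨y, hy⟩
    obtain ⟨i, hi⟩ := hx.2 (Quotient.mk'' y)
    exact ⟨⟨i, ⟨y, Quotient.exact' hi.symm⟩, hy⟩, rfl⟩

/-- Averaging the definition over the starting point in the orbit of `x`. This form makes the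
lumped chain visibly symmetric and positive semidefinite. -/
theorem burnsideOrbitKernel_mk [Fintype G] [Finite X] (x z : X) :
    burnsideOrbitKernel G X (Quotient.mk'' x) (Quotient.mk'' z) = (Nat.card G : ℝ)⁻¹ *
      ∑ g : G, orbitFixCount x g * orbitFixCount z g / Nat.card (fixedBy X g) := by
  classical
  have := Fintype.ofFinite X
  -- `h g` is the probability that a uniform fixed point of `g` lies in the orbit of `z`.
  set h : G → ℝ := fun g => orbitFixCount z g / Nat.card (fixedBy X g) with hh
  have hconj : ∀ u g : G, h (u * g * u⁻¹) = h g := by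
    intro u g
    simp only [hh, orbitFixCount]
    congr 2
    · refine Nat.card_congr (((MulAction.toPerm u⁻¹).subtypeEquiv fun y => ?_))
      simp [mul_smul, smul_eq_iff_eq_inv_smul u]
    · refine Nat.card_congr ((MulAction.toPerm u⁻¹).subtypeEquiv fun y => ?_)
      simp [mul_smul, smul_eq_iff_eq_inv_smul u]
  have hS : (Nat.card (stabilizer G x) : ℝ) ≠ 0 := by
    exact_mod_cast Nat.card_pos.ne'
  have hG : (Nat.card G : ℝ) ≠ 0 := by
    exact_mod_cast Nat.card_pos.ne'
  have hL : burnsideOrbitKernel G X (Quotient.mk'' x) (Quotient.mk'' z) =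
      (Nat.card (stabilizer G x) : ℝ)⁻¹ * ∑ g : G, if g • x = x then h g else 0 := by
    change ∑ᶠ y ∈ orbitRel.Quotient.orbit (Quotient.mk'' z), burnsideKernel G x y = _
    rw [orbitRel.Quotient.orbit_mk, ← finsum_set_coe_eq_finsum_mem, finsum_eq_sum_of_fintype]
    simp only [burnsideKernel]
    rw [← Finset.mul_sum]
    congr 1
    have : ∀ y : orbit G z, (∑ᶠ g ∈ (stabilizer G x ⊓ stabilizer G (y : X) : Subgroup G),
        (Nat.card (fixedBy X g) : ℝ)⁻¹) = ∑ g : G, if g • x = x then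
          (if g • (y : X) = y then 1 else 0) * (Nat.card (fixedBy X g) : ℝ)⁻¹ else 0 := by
      intro y
      rw [finsum_eq_sum_of_fintype]
      refine Finset.sum_congr rfl fun g _ => ?_
      rw [finsum_eq_if]
      simp only [Subgroup.mem_inf, mem_stabilizer_iff]
      by_cases h1 : g • x = x <;> by_cases h2 : g • (y : X) = y <;> simp [h1, h2]
    simp only [this]
    rw [Finset.sum_comm]
    refine Finset.sum_congr rfl fun g _ => ?_
    split_ifs with hg
    · rw [← Finset.sum_mul, ← natCard_subtype_eq_sum_ite, ← div_eq_mul_inv]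
      rfl
    · simp
  have hR : (Nat.card (stabilizer G x) : ℝ) * ∑ g : G, orbitFixCount x g * h g =
      Nat.card G * ∑ g : G, if g • x = x then h g else 0 := by
    rw [Finset.mul_sum]
    simp_rw [← mul_assoc, card_stabilizer_mul_orbitFixCount]
    simp_rw [natCard_subtype_eq_sum_ite, Finset.sum_mul]
    rw [Finset.sum_comm]
    have : ∀ u : G, ∑ g : G, (if g • u • x = u • x then 1 else 0) * h g =
        ∑ g : G, if g • x = x then h g else 0 := by
      intro u
      refine (Fintype.sum_equiv (MulAut.conj u).toEquiv _ _ fun g => ?_).symm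
      simp [hconj, mul_smul]
    simp only [this, Finset.sum_const, Finset.card_univ, nsmul_eq_mul, Nat.card_eq_fintype_card]
  rw [hL]
  simp only [mul_div_assoc]
  change _ = _ * ∑ g : G, orbitFixCount x g * h g
  field_simp
  linarith

end OrbitFormula

/-! ### Stabilizers in the unipotent group and the Bruhat decomposition -/

section Bruhat

open Matrix

theorem permGL_inv_mul_mul_apply {n : ℕ} {F : Type*} [Field F] (w z : Equiv.Perm (Fin n))
    (g : GL (Fin n) F) (i j : Fin n) :
    ((permGL F w)⁻¹ * g * permGL F z : GL (Fin n) F) i j = g (w i) (z j) := by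
  change (w.permMatrix F * (g : Matrix (Fin n) (Fin n) F) * z⁻¹.permMatrix F) i j = _
  simp only [Equiv.Perm.permMatrix, PEquiv.toMatrix_toPEquiv_mul, PEquiv.mul_toMatrix_toPEquiv]
  rfl

theorem flag_mk_eq_mk_iff {n : ℕ} {F : Type*} [Field F] (g h : GL (Fin n) F) :
    (QuotientGroup.mk g : FlagVariety n F) = QuotientGroup.mk h ↔
      ∀ i j, j < i → (g⁻¹ * h : GL (Fin n) F) i j = 0 := by
  rw [QuotientGroup.eq]
  exact ⟨fun H i j hij => H hij, fun H i j hij => H i j hij⟩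

theorem flag_smul_permGL_eq_iff {n : ℕ} {F : Type*} [Field F] (g : upperUnipotent n F)
    (w : Equiv.Perm (Fin n)) :
    g • (QuotientGroup.mk (permGL F w) : FlagVariety n F) = QuotientGroup.mk (permGL F w) ↔
      ∀ i j, j < i → (g : GL (Fin n) F) (w i) (w j) = 0 := by
  rw [eq_comm]
  change (QuotientGroup.mk (permGL F w) : FlagVariety n F) =
    QuotientGroup.mk ((g : GL (Fin n) F) * permGL F w) ↔ _
  rw [flag_mk_eq_mk_iff]
  simp only [← mul_assoc, permGL_inv_mul_mul_apply]

theorem bruhatCell_injective (n : ℕ) (F : Type*) [Field F] :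
    Function.Injective (bruhatCell (n := n) F) := by
  intro w z h
  obtain ⟨u, hu⟩ := Quotient.exact' h
  have hu' : (QuotientGroup.mk (permGL F w) : FlagVariety n F) =
    QuotientGroup.mk ((u : GL (Fin n) F) * permGL F z) := hu.symm
  rw [flag_mk_eq_mk_iff] at hu'
  simp only [← mul_assoc, permGL_inv_mul_mul_apply] at hu'
  -- The diagonal entries of `u` equal `1`, so `w⁻¹ z` cannot raise any index.
  have hle : ∀ j, (w⁻¹ * z) j ≤ j := by
    intro j
    by_contra! hj
    have := hu' _ _ hj
    simp [u.2.2] at this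
  have h1 : w⁻¹ * z = 1 := by
    ext1 j
    induction j using WellFoundedLT.induction with
    | ind j ih =>
      refine (hle j).eq_of_not_lt fun hj => hj.ne ?_
      exact (w⁻¹ * z).injective (ih _ hj)
  exact (inv_mul_eq_one.mp h1)

end Bruhat

/-! ### Coordinates on the unipotent group of `GL₃` -/

section Heisenberg

variable {F : Type*} [Field F]

/-- The unipotent matrix with entries `a`, `b` above the diagonal and `c` in the corner. -/
def unipotentMk (a b c : F) : upperUnipotent 3 F :=
  ⟨{ val := !![1, a, c; 0, 1, b; 0, 0, 1]
     inv := !![1, -a, a * b - c; 0, 1, -b; 0, 0, 1]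
     val_inv := by
      ext i j; fin_cases i <;> fin_cases j <;> simp [Matrix.mul_apply, Fin.sum_univ_three]; ring
     inv_val := by
      ext i j; fin_cases i <;> fin_cases j <;> simp [Matrix.mul_apply, Fin.sum_univ_three]; ring }, by
    constructor
    · intro i j h
      fin_cases i <;> fin_cases j <;> first | rfl | exact absurd h (by decide)
    · intro i
      fin_cases i <;> rfl⟩

theorem coe_unipotentMk (a b c : F) :
    (((unipotentMk a b c : upperUnipotent 3 F) : GL (Fin 3) F) : Matrix (Fin 3) (Fin 3) F) =
      !![1, a, c; 0, 1, b; 0, 0, 1] := rfl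

variable (F) in
/-- The entries above the diagonal are coordinates on the unipotent group. -/
def unipotentEquiv : F × F × F ≃ upperUnipotent 3 F where
  toFun p := unipotentMk p.1 p.2.1 p.2.2
  invFun g := ((g : GL (Fin 3) F) 0 1, (g : GL (Fin 3) F) 1 2, (g : GL (Fin 3) F) 0 2)
  left_inv p := rfl
  right_inv g := by
    obtain ⟨g, hg, hd⟩ := g
    ext i j
    have h := @hg i j
    have h' := hd i
    fin_cases i <;> fin_cases j <;> simp_all [coe_unipotentMk]

theorem unipotentMk_conj (a b c x y z : F) :
    (unipotentMk x y z)⁻¹ * unipotentMk a b c * unipotentMk x y z =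
      unipotentMk a b (c + a * y - b * x) := by
  rw [mul_assoc, inv_mul_eq_iff_eq_mul]
  ext i j
  simp only [Subgroup.coe_mul, Units.val_mul, coe_unipotentMk]
  fin_cases i <;> fin_cases j <;> simp [Matrix.mul_apply, Fin.sum_univ_three] <;> ring

end Heisenberg

/-! ### The six cells -/

section SixCells

open Equiv MulAction

theorem forall_lt_fin_three {P : Fin 3 → Fin 3 → Prop} :
    (∀ i j, j < i → P i j) ↔ P 1 0 ∧ P 2 0 ∧ P 2 1 := by
  refine ⟨fun h => ⟨h _ _ (by decide), h _ _ (by decide), h _ _ (by decide)⟩, ?_⟩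
  rintro ⟨h1, h2, h3⟩ i j hij
  fin_cases i <;> fin_cases j <;> first | assumption | exact absurd hij (by decide)

/-- The Bruhat decomposition for `GL₃`, by Gaussian elimination with row operations from `U`. -/
theorem bruhatCell_three_surjective (F : Type*) [Field F] :
    Function.Surjective (bruhatCell (n := 3) F) := by
  intro O
  induction O using Quotient.inductionOn' with | h y =>
  induction y using QuotientGroup.induction_on with | H g =>
  suffices h : ∃ (w : Equiv.Perm (Fin 3)) (a b c : F), ∀ i j, j < i →
      (!![1, a, c; 0, 1, b; 0, 0, 1] * (g : Matrix (Fin 3) (Fin 3) F)) (w i) j = 0 by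
    obtain ⟨w, a, b, c, h⟩ := h
    refine ⟨w, Quotient.sound' ⟨unipotentMk a b c, ?_⟩⟩
    symm
    change QuotientGroup.mk (permGL F w) =
      QuotientGroup.mk (((unipotentMk a b c : upperUnipotent 3 F) : GL (Fin 3) F) * g)
    rw [flag_mk_eq_mk_iff]
    intro i j hij
    have := permGL_inv_mul_mul_apply w 1 (((unipotentMk a b c : upperUnipotent 3 F) : GL (Fin 3) F) * g) i j
    rw [show permGL F (1 : Equiv.Perm (Fin 3)) = 1 by ext; simp [permGL], mul_one] at this
    rw [this]
    exact h i j hij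
  simp only [forall_lt_fin_three]
  -- `w` is found from the lowest nonzero entry of the first column and then from the lowest
  -- nonzero minor of the first two columns; row operations clear the remaining entries.
  by_cases h20 : (g : Matrix (Fin 3) (Fin 3) F) 2 0 = 0
  · by_cases h10 : (g : Matrix (Fin 3) (Fin 3) F) 1 0 = 0
    · by_cases h21 : (g : Matrix (Fin 3) (Fin 3) F) 2 1 = 0
      · refine ⟨1, 0, 0, 0, ?_⟩
        simp [Matrix.mul_apply, Fin.sum_univ_three, *]
      · refine ⟨swap 1 2, 0, -(g 1 1 / g 2 1), 0, ?_⟩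
        simp [Matrix.mul_apply, Fin.sum_univ_three, *]
    · by_cases h21 : (g : Matrix (Fin 3) (Fin 3) F) 2 1 = 0
      · refine ⟨swap 0 1, -(g 0 0 / g 1 0), 0, 0, ?_⟩
        simp [Matrix.mul_apply, Fin.sum_univ_three, swap_apply_def, *]
      · refine ⟨swap 0 1 * swap 1 2, -(g 0 0 / g 1 0), 0,
          -((g 0 1 - g 0 0 / g 1 0 * g 1 1) / g 2 1), ?_⟩
        simp [Matrix.mul_apply, Fin.sum_univ_three, swap_apply_def, *]
        ring
  · by_cases hm : (g : Matrix (Fin 3) (Fin 3) F) 1 0 * g 2 1 - g 1 1 * g 2 0 = 0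
    · refine ⟨swap 1 2 * swap 0 1, 0, -(g 1 0 / g 2 0), -(g 0 0 / g 2 0), ?_⟩
      simp [Matrix.mul_apply, Fin.sum_univ_three, swap_apply_def, *]
      field_simp
      linear_combination -hm
    · obtain ⟨d, hd⟩ : ∃ d, (g : Matrix (Fin 3) (Fin 3) F) 1 0 * g 2 1 - g 1 1 * g 2 0 = d :=
        ⟨_, rfl⟩
      rw [hd] at hm
      refine ⟨swap 0 2, -((g 0 0 * g 2 1 - g 0 1 * g 2 0) / d), -(g 1 0 / g 2 0),
        -((g 0 1 * g 1 0 - g 0 0 * g 1 1) / d), ?_⟩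
      simp [Matrix.mul_apply, Fin.sum_univ_three, swap_apply_def, h20]
      constructor <;> field_simp <;> rw [← hd] <;> ring

theorem natCard_triple {F : Type*} [Fintype F] (P : F × F × F → Prop) [DecidablePred P] :
    (Nat.card {p // P p} : ℝ) = ∑ x, ∑ y, ∑ z, if P (x, y, z) then 1 else 0 := by
  rw [natCard_subtype_eq_sum_ite, Fintype.sum_prod_type]
  simp only [Fintype.sum_prod_type]

/-- The fixed points of `g` in the cell of `w`, in coordinates: `u w B` is fixed by `g` exactly
when the entries of `u⁻¹ g u` at the inversions of `w` vanish. -/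
theorem card_mul_orbitFixCount_permGL {F : Type*} [Field F] (w : Equiv.Perm (Fin 3)) (a b c : F) :
    (Nat.card {p : F × F × F // ∀ i j, j < i →
        !![1, p.1, p.2.2; 0, 1, p.2.1; 0, 0, 1] (w i) (w j) = 0} : ℝ) *
      orbitFixCount (QuotientGroup.mk (permGL F w) : FlagVariety 3 F) (unipotentMk a b c) =
    Nat.card {p : F × F × F // ∀ i j, j < i →
      !![1, a, c + a * p.2.1 - b * p.1; 0, 1, b; 0, 0, 1] (w i) (w j) = 0} := by
  convert card_stabilizer_mul_orbitFixCount
    (QuotientGroup.mk (permGL F w) : FlagVariety 3 F) (unipotentMk a b c) using 2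
  · congr 1
    refine Nat.card_congr ((unipotentEquiv F).subtypeEquiv fun p => ?_)
    rw [mem_stabilizer_iff, flag_smul_permGL_eq_iff]
    rfl
  · refine Nat.card_congr ((unipotentEquiv F).subtypeEquiv fun p => ?_)
    rw [← inv_smul_eq_iff, smul_smul, smul_smul]
    change _ ↔ ((unipotentMk p.1 p.2.1 p.2.2)⁻¹ * _ * unipotentMk p.1 p.2.1 p.2.2) • _ = _
    rw [unipotentMk_conj, flag_smul_permGL_eq_iff]
    rfl

variable {F : Type*} [Field F] [Fintype F]

/-- The permutations of `Fin 3`, by increasing length. -/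
noncomputable def weylThree : Fin 6 ≃ Perm (Fin 3) :=
  Equiv.ofBijective
    ![1, swap 0 1, swap 1 2, swap 0 1 * swap 1 2, swap 1 2 * swap 0 1, swap 0 2] (by decide)

/-- The numbers of fixed points in the six cells, ordered as in `weylThree`, of the unipotent
matrix with entries `a`, `b` above the diagonal and `c` in the corner. -/
noncomputable def cellFixVec [DecidableEq F] (a b c : F) : Fin 6 → ℝ :=
  let q : ℝ := Fintype.card F
  if a = 0 then
    if b = 0 then
      if c = 0 then ![1, q, q, q ^ 2, q ^ 2, q ^ 3] else ![1, q, q, 0, 0, 0]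
    else ![1, q, 0, q, 0, 0]
  else if b = 0 then ![1, 0, q, 0, q, 0] else ![1, 0, 0, 0, 0, 0]

theorem orbitFixCount_weylThree [DecidableEq F] (i : Fin 6) (a b c : F) :
    orbitFixCount (QuotientGroup.mk (permGL F (weylThree i)) : FlagVariety 3 F)
      (unipotentMk a b c) = cellFixVec a b c i := by
  have hq : (Fintype.card F : ℝ) ≠ 0 := by exact_mod_cast Fintype.card_ne_zero
  have h := card_mul_orbitFixCount_permGL (weylThree i) a b c
  simp only [forall_lt_fin_three, natCard_triple] at h
  -- The corner entry `c + a y - b x` of a conjugate, when only one of `a`, `b` is nonzero.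
  have hx : ∀ x : F, b ≠ 0 → (c - b * x = 0 ↔ x = c / b) := fun x hb => by
    field_simp; rw [sub_eq_zero, eq_comm, mul_comm]
  have hy : ∀ y : F, a ≠ 0 → (c + a * y = 0 ↔ y = - c / a) := fun y ha => by
    field_simp; rw [add_comm, add_eq_zero_iff_eq_neg, mul_comm]
  unfold cellFixVec
  by_cases ha : a = 0 <;> by_cases hb : b = 0 <;> by_cases hc : c = 0 <;> fin_cases i <;>
  simp [weylThree, ofBijective_apply, swap_apply_def, ha, hb, hc, hx, hy, ite_and, hq,
    -Finset.sum_boole] at h ⊢ <;>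
  first
  | exact h
  | linear_combination h
  | exact mul_left_cancel₀ (mul_ne_zero hq hq) (by linear_combination h)

/-! ### The lumped transition matrix -/

theorem sum_ite_eq_zero (A B : ℝ) [DecidableEq F] :
    ∑ x : F, (if x = 0 then A else B) = A + ((Fintype.card F : ℝ) - 1) * B := by
  have : ∀ x : F, (if x = 0 then A else B) = (if x = 0 then A - B else 0) + B := by
    intro x; split_ifs <;> ring
  simp only [this, Finset.sum_add_distrib, Finset.sum_ite_eq', Finset.mem_univ, if_true,
    Finset.sum_const, Finset.card_univ, nsmul_eq_mul]
  ring

theorem sum_triple_ite_eq_zero [DecidableEq F] (T₀ T₁ T₂ T₃ T₄ : ℝ) :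
    (∑ a : F, ∑ b : F, ∑ c : F, if a = 0 then if b = 0 then if c = 0 then T₀ else T₁ else T₂
      else if b = 0 then T₃ else T₄) =
    T₀ + (Fintype.card F - 1) * T₁ + Fintype.card F * (Fintype.card F - 1) * T₂ +
      Fintype.card F * (Fintype.card F - 1) * T₃ +
      Fintype.card F * ((Fintype.card F : ℝ) - 1) ^ 2 * T₄ := by
  set q : ℝ := (Fintype.card F : ℝ) with hq
  have h1 : ∀ a b : F, (∑ c : F, if a = 0 then if b = 0 then if c = 0 then T₀ else T₁ else T₂
      else if b = 0 then T₃ else T₄) = if a = 0 then if b = 0 then T₀ + (q - 1) * T₁ else q * T₂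
      else if b = 0 then q * T₃ else q * T₄ := by
    intro a b
    split_ifs
    · rw [sum_ite_eq_zero]
    all_goals rw [Finset.sum_const, Finset.card_univ, nsmul_eq_mul]
  have h2 : ∀ a : F, (∑ b : F, if a = 0 then if b = 0 then T₀ + (q - 1) * T₁ else q * T₂
      else if b = 0 then q * T₃ else q * T₄) =
      if a = 0 then T₀ + (q - 1) * T₁ + (q - 1) * (q * T₂) else
        q * T₃ + (q - 1) * (q * T₄) := by
    intro a
    split_ifs <;> rw [sum_ite_eq_zero]
  simp only [h1, h2, sum_ite_eq_zero]
  ring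

/-- The fixed point counts of the five kinds of unipotent elements: the identity, the central
transvections, those with only `b ≠ 0`, those with only `a ≠ 0`, and the regular elements. -/
def fixVec (q : ℝ) : Fin 5 → Fin 6 → ℝ :=
  ![![1, q, q, q ^ 2, q ^ 2, q ^ 3], ![1, q, q, 0, 0, 0], ![1, q, 0, q, 0, 0],
    ![1, 0, q, 0, q, 0], ![1, 0, 0, 0, 0, 0]]

/-- The proportion of each kind of element in `U`, divided by its number of fixed flags. -/
noncomputable def fixWeight (q : ℝ) : Fin 5 → ℝ :=
  ![1 / (q ^ 3 * ((q + 1) * (q ^ 2 + q + 1))), (q - 1) / (q ^ 3 * (2 * q + 1)),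
    q * (q - 1) / (q ^ 3 * (2 * q + 1)), q * (q - 1) / (q ^ 3 * (2 * q + 1)),
    q * (q - 1) ^ 2 / q ^ 3]

/-- The lumped transition matrix on the six cells, as a function of `q`. -/
noncomputable def lumpedMatrix (q : ℝ) : Matrix (Fin 6) (Fin 6) ℝ :=
  Matrix.of fun i j => ∑ k, fixWeight q k * fixVec q k i * fixVec q k j

theorem bijective_mk_permGL_weylThree (F : Type*) [Field F] :
    Function.Bijective fun i => (Quotient.mk'' (QuotientGroup.mk (permGL F (weylThree i))) :
      orbitRel.Quotient (upperUnipotent 3 F) (FlagVariety 3 F)) :=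
  Function.Bijective.comp (g := bruhatCell (n := 3) F) ⟨bruhatCell_injective 3 F, bruhatCell_three_surjective F⟩
    weylThree.bijective

theorem flagBurnsideMatrix_three_eq (F : Type*) [Field F] [Fintype F] :
    flagBurnsideMatrix 3 F =
      Matrix.reindexAlgEquiv ℝ ℝ weylThree (lumpedMatrix (Fintype.card F)) := by
  classical
  have := Fintype.ofEquiv _ (unipotentEquiv F)
  have hq : (Fintype.card F : ℝ) ≠ 0 := by exact_mod_cast Fintype.card_ne_zero
  suffices h : ∀ i j, flagBurnsideMatrix 3 F (weylThree i) (weylThree j) =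
      lumpedMatrix (Fintype.card F) i j by
    ext w z
    simpa using h (weylThree.symm w) (weylThree.symm z)
  intro i j
  have hU : (Nat.card (upperUnipotent 3 F) : ℝ) = (Fintype.card F : ℝ) ^ 3 := by
    rw [← Nat.card_congr (unipotentEquiv F), Nat.card_prod, Nat.card_prod,
      Nat.card_eq_fintype_card]
    push_cast
    ring
  change burnsideOrbitKernel (upperUnipotent 3 F) (FlagVariety 3 F)
    (Quotient.mk'' (QuotientGroup.mk (permGL F (weylThree i))))
    (Quotient.mk'' (QuotientGroup.mk (permGL F (weylThree j)))) = _
  rw [burnsideOrbitKernel_mk, hU, ← (unipotentEquiv F).sum_comp]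
  simp only [card_fixedBy_eq_sum_orbitFixCount (bijective_mk_permGL_weylThree F)]
  simp only [Fintype.sum_prod_type]
  have hterm : ∀ a b c : F,
      orbitFixCount (QuotientGroup.mk (permGL F (weylThree i)) : FlagVariety 3 F)
        (unipotentEquiv F (a, b, c)) *
      orbitFixCount (QuotientGroup.mk (permGL F (weylThree j)) : FlagVariety 3 F)
        (unipotentEquiv F (a, b, c)) /
      ∑ k, orbitFixCount (QuotientGroup.mk (permGL F (weylThree k)) : FlagVariety 3 F)
        (unipotentEquiv F (a, b, c)) =
      let q : ℝ := Fintype.card F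
      let T : Fin 5 → ℝ := fun k => fixVec q k i * fixVec q k j / ∑ m, fixVec q k m
      if a = 0 then if b = 0 then if c = 0 then T 0 else T 1 else T 2
        else if b = 0 then T 3 else T 4 := by
    intro a b c
    change orbitFixCount _ (unipotentMk a b c) * orbitFixCount _ (unipotentMk a b c) /
      ∑ k, orbitFixCount _ (unipotentMk a b c) = _
    simp only [orbitFixCount_weylThree, cellFixVec]
    split_ifs <;> rfl
  simp only [hterm]
  rw [sum_triple_ite_eq_zero]
  set q : ℝ := (Fintype.card F : ℝ)
  have hq0 : 0 < q := by positivity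
  have s0 : ∑ m, fixVec q 0 m = (q + 1) * (q ^ 2 + q + 1) := by
    simp [fixVec, Fin.sum_univ_succ]; ring
  have s1 : ∑ m, fixVec q 1 m = 2 * q + 1 := by simp [fixVec, Fin.sum_univ_succ]; ring
  have s2 : ∑ m, fixVec q 2 m = 2 * q + 1 := by simp [fixVec, Fin.sum_univ_succ]; ring
  have s3 : ∑ m, fixVec q 3 m = 2 * q + 1 := by simp [fixVec, Fin.sum_univ_succ]; ring
  have s4 : ∑ m, fixVec q 4 m = 1 := by simp [fixVec, Fin.sum_univ_succ]
  simp only [s0, s1, s2, s3, s4, lumpedMatrix, Matrix.of_apply, Fin.sum_univ_five]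
  simp only [fixWeight, Matrix.cons_val]
  field_simp

end SixCells

/-! ### Contraction of a positive semidefinite doubly stochastic matrix -/

section Contraction

open Matrix

/-- A positive semidefinite form bounded by `β` on the vectors of sum zero comes from a matrix of
operator norm at most `β` there; the proof evaluates the form at `β v - M v`, which avoids square
roots and eigenvectors. -/
theorem Matrix.dotProduct_mulVec_self_le_sq {α : Type*} [Fintype α] {M : Matrix α α ℝ} {β : ℝ}
    (hβ : 0 < β) (hsymm : M.IsSymm) (hpsd : ∀ v, 0 ≤ v ⬝ᵥ M *ᵥ v)
    (hsum : ∀ v, ∑ i, (M *ᵥ v) i = ∑ i, v i)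
    (hle : ∀ v, ∑ i, v i = 0 → v ⬝ᵥ M *ᵥ v ≤ β * (v ⬝ᵥ v)) {v : α → ℝ} (hv : ∑ i, v i = 0) :
    (M *ᵥ v) ⬝ᵥ (M *ᵥ v) ≤ β ^ 2 * (v ⬝ᵥ v) := by
  set w := M *ᵥ v with hw
  have h1 := hle v hv
  have h2 := hle w (by rw [hw, hsum, hv])
  have hsw : v ⬝ᵥ M *ᵥ w = w ⬝ᵥ w := by
    rw [dotProduct_mulVec, ← mulVec_transpose, hsymm.eq]
  have h3 := hpsd (β • v - w)
  rw [mulVec_sub, mulVec_smul, sub_dotProduct, dotProduct_sub, dotProduct_sub, smul_dotProduct,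
    smul_dotProduct, dotProduct_smul, dotProduct_smul, hsw, ← hw] at h3
  simp only [smul_eq_mul] at h3
  rw [← hw] at h1
  have h4 : β * (β * (v ⬝ᵥ w)) ≤ β * (β * (β * (v ⬝ᵥ v))) := by gcongr
  have h5 : β * (w ⬝ᵥ w) ≤ β * (β ^ 2 * (v ⬝ᵥ v)) := by linarith
  exact le_of_mul_le_mul_left h5 hβ

/-- The `ℓ²` distance of the rows of `M ^ l` to the uniform distribution shrinks by `β` at each
step from its initial value `√(1 - 1 / n)`, and Cauchy-Schwarz bounds the `ℓ¹` distance by `√n`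
times the `ℓ²` distance. -/
theorem tvDist_pow_le {α : Type*} [Fintype α] [DecidableEq α] {M : Matrix α α ℝ} {β : ℝ}
    (hβ : 0 < β) (hsymm : M.IsSymm) (hpsd : ∀ v, 0 ≤ v ⬝ᵥ M *ᵥ v)
    (hone : M *ᵥ (fun _ => 1) = fun _ => 1)
    (hle : ∀ v, ∑ i, v i = 0 → v ⬝ᵥ M *ᵥ v ≤ β * (v ⬝ᵥ v)) (l : ℕ) (x : α) :
    tvDist ((M ^ l) x) (fun _ => 1 / (Fintype.card α : ℝ)) ≤
      (1 / 2) * √(Fintype.card α - 1) * β ^ l := by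
  have : Nonempty α := ⟨x⟩
  have hn : (1 : ℝ) ≤ Fintype.card α := by exact_mod_cast Fintype.card_pos
  set n : ℝ := (Fintype.card α : ℝ) with hndef
  have hsum : ∀ v, ∑ i, (M *ᵥ v) i = ∑ i, v i := fun v => by
    have h : (fun _ => 1) ⬝ᵥ M *ᵥ v = (fun _ => 1) ⬝ᵥ v := by
      rw [dotProduct_mulVec, ← mulVec_transpose, hsymm.eq, hone]
    simpa [dotProduct] using h
  let r : ℕ → α → ℝ := fun k z => (M ^ k) x z - 1 / n
  have hr : ∀ k, r (k + 1) = M *ᵥ r k := fun k => by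
    have h1 : (M ^ (k + 1)) x = M *ᵥ (M ^ k) x := by
      have h := mulVec_transpose M ((M ^ k) x)
      rw [hsymm.eq] at h
      rw [h, pow_succ]
      rfl
    have h2 : r k = (M ^ k) x - (1 / n) • (fun _ => 1) := by
      ext z; simp [r]
    rw [h2, mulVec_sub, mulVec_smul, hone, ← h1]
    ext z; simp [r]
  have key : ∀ k, ∑ z, r k z = 0 ∧ r k ⬝ᵥ r k ≤ (β ^ k) ^ 2 * (1 - 1 / n) := by
    intro k
    induction k with
    | zero =>
      constructor
      · simp only [r, pow_zero, Finset.sum_sub_distrib, one_apply]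
        simp only [Finset.sum_ite_eq, Finset.mem_univ, if_true, Finset.sum_const,
          Finset.card_univ, nsmul_eq_mul, ← hndef]
        field_simp
        ring
      · have h : r 0 ⬝ᵥ r 0 = 1 - 1 / n := by
          have : ∀ z, r 0 z * r 0 z = (1 - 2 / n) * (if x = z then 1 else 0) + 1 / n ^ 2 := by
            intro z
            simp only [r, pow_zero, one_apply]
            split_ifs <;> ring
          simp only [dotProduct, this, Finset.sum_add_distrib, ← Finset.mul_sum,
            Finset.sum_ite_eq, Finset.mem_univ, if_true, Finset.sum_const,
            Finset.card_univ, nsmul_eq_mul, ← hndef]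
          field_simp
          ring
        rw [h]; simp
    | succ k ih =>
      rw [hr]
      refine ⟨by rw [hsum, ih.1], ?_⟩
      calc _ ≤ β ^ 2 * (r k ⬝ᵥ r k) :=
            dotProduct_mulVec_self_le_sq hβ hsymm hpsd hsum hle ih.1
        _ ≤ β ^ 2 * ((β ^ k) ^ 2 * (1 - 1 / n)) := by gcongr; exact ih.2
        _ = _ := by ring
  have hcs : (∑ z, |r l z|) ^ 2 ≤ (n - 1) * (β ^ l) ^ 2 := by
    calc (∑ z, |r l z|) ^ 2 ≤ n * ∑ z, |r l z| ^ 2 := by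
          simpa [hndef] using sq_sum_le_card_mul_sum_sq (s := Finset.univ) (f := fun z => |r l z|)
      _ = n * (r l ⬝ᵥ r l) := by simp only [sq_abs, dotProduct, ← sq]
      _ ≤ n * ((β ^ l) ^ 2 * (1 - 1 / n)) := by gcongr; exact (key l).2
      _ = _ := by field_simp
  have h := Real.le_sqrt_of_sq_le hcs
  rw [Real.sqrt_mul (by linarith), Real.sqrt_sq (by positivity)] at h
  change (1 / 2) * ∑ z, |r l z| ≤ _
  linarith

/-- An eigenvector with entries in `[-1, 1]` is a test function for the total variation
distance. -/
theorem le_tvDist_pow {α : Type*} [Fintype α] [DecidableEq α] {M : Matrix α α ℝ} {β c : ℝ}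
    {f : α → ℝ} (hf : M *ᵥ f = β • f) (hsum : ∑ i, f i = 0) (hb : ∀ i, |f i| ≤ 1)
    (l : ℕ) (x : α) (hx : |f x| = 1) :
    (1 / 2) * β ^ l ≤ tvDist ((M ^ l) x) (fun _ => c) := by
  have hpow : (M ^ l) *ᵥ f = β ^ l • f := by
    induction l with
    | zero => simp
    | succ k ih => rw [pow_succ, ← mulVec_mulVec, hf, mulVec_smul, ih, smul_smul, pow_succ,
        mul_comm]
  have h1 : ∑ z, ((M ^ l) x z - c) * f z = β ^ l * f x := by
    simp only [sub_mul, Finset.sum_sub_distrib, ← Finset.mul_sum, hsum, mul_zero, sub_zero]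
    exact congrFun hpow x
  unfold tvDist
  refine mul_le_mul_of_nonneg_left ?_ (by norm_num)
  calc β ^ l ≤ |β ^ l * f x| := by rw [abs_mul, hx, mul_one]; exact le_abs_self _
    _ ≤ ∑ z, |((M ^ l) x z - c) * f z| := by rw [← h1]; exact Finset.abs_sum_le_sum_abs _ _
    _ ≤ _ := by
      refine Finset.sum_le_sum fun z _ => ?_
      rw [abs_mul]
      exact mul_le_of_le_one_right (abs_nonneg _) (hb z)

end Contraction

/-! ### The spectral gap -/

section SpectralGap

open Matrix

theorem fixWeight_nonneg {q : ℝ} (hq : 1 < q) (k : Fin 5) : 0 ≤ fixWeight q k := by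
  have : 0 < q - 1 := by linarith
  fin_cases k <;> simp [fixWeight] <;> positivity

theorem lumpedMatrix_isSymm (q : ℝ) : (lumpedMatrix q).IsSymm := by
  ext i j
  simp only [transpose_apply, lumpedMatrix, of_apply]
  exact Finset.sum_congr rfl fun k _ => by ring

theorem lumpedMatrix_mulVec_apply (q : ℝ) (f : Fin 6 → ℝ) (i : Fin 6) :
    (lumpedMatrix q *ᵥ f) i = ∑ k, fixWeight q k * fixVec q k i * (fixVec q k ⬝ᵥ f) := by
  simp only [mulVec, dotProduct, lumpedMatrix, of_apply, Finset.sum_mul, Finset.mul_sum]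
  rw [Finset.sum_comm]
  simp only [mul_assoc]

theorem dotProduct_lumpedMatrix_mulVec (q : ℝ) (f : Fin 6 → ℝ) :
    f ⬝ᵥ lumpedMatrix q *ᵥ f = ∑ k, fixWeight q k * (fixVec q k ⬝ᵥ f) ^ 2 := by
  have h : f ⬝ᵥ lumpedMatrix q *ᵥ f =
      ∑ i, f i * ∑ k, fixWeight q k * fixVec q k i * (fixVec q k ⬝ᵥ f) :=
    Finset.sum_congr rfl fun i _ => by rw [lumpedMatrix_mulVec_apply]
  simp only [h, Finset.mul_sum]
  rw [Finset.sum_comm]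
  refine Finset.sum_congr rfl fun k _ => ?_
  rw [sq, ← mul_assoc, dotProduct, Finset.mul_sum]
  exact Finset.sum_congr rfl fun i _ => by ring

theorem lumpedMatrix_mulVec_one {q : ℝ} (hq : 1 < q) :
    lumpedMatrix q *ᵥ (fun _ => 1) = fun _ => 1 := by
  have h0 : q ≠ 0 := by positivity
  have h1 : 2 * q + 1 ≠ 0 := by positivity
  have h2 : q + 1 ≠ 0 := by positivity
  have h3 : q ^ 2 + q + 1 ≠ 0 := by positivity
  ext i
  rw [lumpedMatrix_mulVec_apply]
  fin_cases i <;> simp [Fin.sum_univ_succ, dotProduct, fixWeight, fixVec] <;> field_simp <;> ring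

/-- An eigenvector for the largest eigenvalue below `1`, antisymmetric under the symmetry that
exchanges the two simple reflections. -/
theorem lumpedMatrix_mulVec_antisymm {q : ℝ} (hq : 1 < q) :
    lumpedMatrix q *ᵥ ![0, 1, -1, 1, -1, 0] = (1 - 3 / (2 * q + 1)) • ![0, 1, -1, 1, -1, 0] := by
  have h0 : q ≠ 0 := by positivity
  have h1 : 2 * q + 1 ≠ 0 := by positivity
  ext i
  rw [lumpedMatrix_mulVec_apply]
  fin_cases i <;> simp [Fin.sum_univ_succ, dotProduct, fixWeight, fixVec] <;> field_simp <;> ring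

/-- On vectors of sum zero, `β ‖f‖² - ⟨f, K f⟩` with `β = 1 - 3 / (2 q + 1)` is an explicit sum of
nonnegative terms. The exchange of the two simple reflections splits it: the last term of `key`
is the antisymmetric part, and the rest is the symmetric part, in the coordinates `f 0`, `s`,
`t`. -/
theorem dotProduct_lumpedMatrix_le {q : ℝ} (hq : 1 < q) (f : Fin 6 → ℝ) (hf : ∑ i, f i = 0) :
    f ⬝ᵥ lumpedMatrix q *ᵥ f ≤ (1 - 3 / (2 * q + 1)) * (f ⬝ᵥ f) := by
  have h0 : 0 < q := by positivity
  have h5 : f 5 = -(f 0 + f 1 + f 2 + f 3 + f 4) := by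
    simp [Fin.sum_univ_succ] at hf
    linear_combination hf
  set s := (f 1 + f 2) / 2 with hs
  set t := (f 3 + f 4) / 2 with ht
  -- The determinant of this binary form is `18 (q ^ 3 - 1)`.
  have hquad : 0 ≤ (q ^ 2 + q + 7) * s ^ 2 - 2 * (q ^ 2 - 5 * q - 5) * s * t +
      (q ^ 2 + 7 * q + 1) * t ^ 2 := by
    have hpos : 0 < q ^ 2 + q + 7 := by positivity
    have hq3 : 0 < q ^ 3 - 1 := by
      have := one_lt_pow₀ hq (n := 3) (by norm_num); linarith
    refine nonneg_of_mul_nonneg_right (a := q ^ 2 + q + 7) ?_ hpos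
    have : 0 ≤ ((q ^ 2 + q + 7) * s - (q ^ 2 - 5 * q - 5) * t) ^ 2 + 18 * (q ^ 3 - 1) * t ^ 2 := by
      positivity
    linarith
  have key : (1 - 3 / (2 * q + 1)) * (f ⬝ᵥ f) - f ⬝ᵥ lumpedMatrix q *ᵥ f =
      (2 * (q ^ 3 - 1) * (f 0 + 2 * t) ^ 2 + 2 * (q ^ 2 - 1) *
        ((q ^ 2 + q + 7) * s ^ 2 - 2 * (q ^ 2 - 5 * q - 5) * s * t +
          (q ^ 2 + 7 * q + 1) * t ^ 2)) / ((q + 1) * (q ^ 2 + q + 1) * (2 * q + 1)) +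
      (q - 1) / (2 * (2 * q + 1)) * (f 1 - f 2 - f 3 + f 4) ^ 2 := by
    rw [dotProduct_lumpedMatrix_mulVec]
    simp only [Fin.sum_univ_five, Fin.sum_univ_six, dotProduct, fixWeight, fixVec, hs, ht,
      Matrix.cons_val, h5]
    field_simp
    ring
  have hq3 : 0 ≤ q ^ 3 - 1 := by
    have := one_le_pow₀ hq.le (n := 3); linarith
  have hq2 : 0 ≤ q ^ 2 - 1 := by
    have := one_le_pow₀ hq.le (n := 2); linarith
  have hq1 : 0 ≤ q - 1 := by linarith
  rw [← sub_nonneg, key]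
  positivity

theorem tvDist_reindex_pow {α γ : Type*} [Fintype α] [Fintype γ] [DecidableEq α] [DecidableEq γ]
    (e : α ≃ γ) (M : Matrix α α ℝ) (c : ℝ) (l : ℕ) (x : γ) :
    tvDist (((Matrix.reindexAlgEquiv ℝ ℝ e M) ^ l) x) (fun _ => c) =
      tvDist ((M ^ l) (e.symm x)) (fun _ => c) := by
  rw [← map_pow]
  unfold tvDist
  congr 1
  exact (e.symm.sum_comp fun a => |(M ^ l) (e.symm x) a - c|)

end SpectralGap

/-! ### Bounds on the total variation distance -/

theorem proposition7 (F : Type*) [Field F] [Fintype F] (l : ℕ) (hl : 1 ≤ l)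
    (x : Equiv.Perm (Fin 3)) :
    tvDist ((flagBurnsideMatrix 3 F ^ l) x) (fun _ => 1 / 6) ≤
        √(3 / 2) * (1 - 3 / (2 * (Fintype.card F : ℝ) + 1)) ^ l ∧
      (x ≠ 1 → x ≠ Fin.revPerm →
        (1 / 2) * (1 - 3 / (2 * (Fintype.card F : ℝ) + 1)) ^ l ≤
          tvDist ((flagBurnsideMatrix 3 F ^ l) x) (fun _ => 1 / 6)) := by
  have hq : (1 : ℝ) < Fintype.card F := by exact_mod_cast Fintype.one_lt_card
  set q : ℝ := (Fintype.card F : ℝ)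
  have hβ : 0 < 1 - 3 / (2 * q + 1) := by
    rw [sub_pos, div_lt_one (by positivity)]
    linarith
  rw [flagBurnsideMatrix_three_eq, tvDist_reindex_pow]
  constructor
  · have h := tvDist_pow_le hβ (lumpedMatrix_isSymm q) (fun v => by
      rw [dotProduct_lumpedMatrix_mulVec]
      refine Finset.sum_nonneg fun k _ => ?_
      exact mul_nonneg (fixWeight_nonneg hq k) (sq_nonneg _))
      (lumpedMatrix_mulVec_one hq) (dotProduct_lumpedMatrix_le hq) l (weylThree.symm x)
    norm_num at h
    -- There are six states, and `√5 / 2 ≤ √(3 / 2)`.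
    refine h.trans ?_
    gcongr
    rw [one_div, inv_mul_le_iff₀ (by norm_num), Real.sqrt_le_iff]
    refine ⟨by positivity, ?_⟩
    rw [mul_pow, Real.sq_sqrt (by norm_num)]
    norm_num
  · intro h1 hrev
    refine le_tvDist_pow (lumpedMatrix_mulVec_antisymm hq) (by simp [Fin.sum_univ_succ]) ?_ l _ ?_
    · intro i; fin_cases i <;> simp
    · obtain ⟨i, rfl⟩ := weylThree.surjective x
      rw [Equiv.symm_apply_apply]
      fin_cases i
      · exact absurd rfl h1
      · simp
      · simp
      · simp
      · simp
      · exact absurd (by decide : (Equiv.swap 0 2 : Equiv.Perm (Fin 3)) = Fin.revPerm) hrev
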